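/- Let $n\ge 2$ and let $\Omega$ be either the unit ball $B_n$ of $\mathbb C^n$, with $\partial\Omega$ the unit sphere and Cauchy kernel $C(z,\zeta)=(1-\langle z,\zeta\rangle)^{-n}$, or the unit polydisc $\mathbb D^n$, with $\partial\Omega$ denoting the torus $\mathbb T^n$ and $C(z,\zeta)=\prod_{j=1}^n(1-z_j\overline{\zeta_j})^{-1}$. Let $P(z,\zeta)=C(z,\zeta)C(\zeta,z)/C(z,z)$ be the Poisson kernel. Let $b:\Omega\to\mathbb D$ be a non-constant holomorphic function, let $\alpha\in\mathbb C$ with $|\alpha|=1$, and let $\sigma_\alpha=\sigma_\alpha[b]$ be the Clark measure, that is, the finite positive Borel measure on $\partial\Omega$ such that $$\int_{\partial\Omega}P(z,\zeta)\,d\sigma_\alpha(\zeta)=\mathrm{Re}\,\frac{\alpha+b(z)}{\alpha-b(z)},\qquad z\in\Omega.$$ Put $k_b(z,w)=(1-b(z)\overline{b(w)})\,C(z,w)$ for $z,w\in\Omega$. This kernel is positive semidefinite; let $\mathcal H(b)$ be the Hilbert space of functions on $\Omega$ with reproducing kernel $k_b$. Let $H^2(\sigma_\alpha)$ be the closed linear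 span of the functions $C(\cdot,w)$, $w\in\Omega$, in $L^2(\sigma_\alpha)$. Let $U_{b,\alpha}$ be the unitary operator from $\mathcal H(b)$ onto $H^2(\sigma_\alpha)$ such that $$U_{b,\alpha}k_b(\cdot,w)=(1-\alpha\overline{b(w)})\,C(\cdot,w),\qquad w\in\Omega;$$ it exists, and it is the only bounded linear operator from $\mathcal H(b)$ to $H^2(\sigma_\alpha)$ with this property. Then the formula $$(V_{b,\alpha}g)(z)=(1-\overline{\alpha}\,b(z))\int_{\partial\Omega}C(z,\xi)\,g(\xi)\,d\sigma_\alpha(\xi),\qquad g\in L^2(\sigma_\alpha),\ z\in\Omega,$$ defines a bounded linear operator $V_{b,\alpha}$ from $L^2(\sigma_\alpha)$ into $\mathcal H(b)$ which is a partial isometry (it is isometric on the orthogonal complement of its kernel). The restriction of $V_{b,\alpha}$ to $H^2(\sigma_\alpha)$ coincides with $U_{b,\alpha}^*$. In particular, $$(V_{b,\alpha}C(\cdot,w))(z)=(1-\alpha\overline{b(w)})^{-1}k_b(z,w),\qquad z,w\in\Omega.$$ -/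

import Mathlib

open MeasureTheory ComplexConjugate InnerProductSpace
open scoped ComplexOrder

noncomputable section

namespace ClarkSeveral

/-- `ℂⁿ` with its Euclidean structure (the norm is only used for the unit ball and sphere). -/
abbrev Cn (n : ℕ) : Type := EuclideanSpace ℂ (Fin n)

/-- The two kinds of domains considered: the unit ball and the unit polydisc. -/
inductive Dom : Type
  | ball : Dom
  | polydisc : Dom

/-- The domain `Ω`: the open unit ball `Bₙ` or the open unit polydisc `𝔻ⁿ`. -/
def Dom.region (D : Dom) (n : ℕ) : Set (Cn n) :=
  match D with
  | .ball => {z | ‖z‖ < 1}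
  | .polydisc => {z | ∀ j, ‖z j‖ < 1}

/-- The set written `∂Ω`: the unit sphere `Sₙ`, or the unit torus `𝕋ⁿ`
(the distinguished boundary of the polydisc). -/
def Dom.bdry (D : Dom) (n : ℕ) : Set (Cn n) :=
  match D with
  | .ball => {z | ‖z‖ = 1}
  | .polydisc => {z | ∀ j, ‖z j‖ = 1}

/-- The Cauchy kernel: `(1 - ⟨z, ζ⟩)⁻ⁿ` for the ball, `∏ⱼ (1 - zⱼ conj ζⱼ)⁻¹` for the polydisc. -/
def Dom.cauchy (D : Dom) {n : ℕ} (z ζ : Cn n) : ℂ :=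
  match D with
  | .ball => 1 / (1 - ∑ j, z j * conj (ζ j)) ^ n
  | .polydisc => ∏ j, 1 / (1 - z j * conj (ζ j))

/-- The Poisson kernel `C(z, ζ) C(ζ, z) / C(z, z)` (it takes nonnegative real values). -/
def Dom.poisson (D : Dom) {n : ℕ} (z ζ : Cn n) : ℂ :=
  D.cauchy z ζ * D.cauchy ζ z / D.cauchy z z

/-- The finite positive Borel measure `σ` on `∂Ω` is the Clark measure `σ_α[b]`: its Poisson
integral is `Re ((α + b) / (α - b))` on `Ω`. -/
def IsClarkMeasure (D : Dom) {n : ℕ} (b : Cn n → ℂ) (α : ℂ) (σ : Measure (D.bdry n))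
    [IsFiniteMeasure σ] : Prop :=
  ∀ z ∈ D.region n, ∫ ζ, D.poisson z (ζ : Cn n) ∂σ = (((α + b z) / (α - b z)).re : ℂ)

/-- The Cauchy transform `(gσ)_+` of the complex measure `gσ`. -/
def cauchyTransform (D : Dom) {n : ℕ} (σ : Measure (D.bdry n)) (g : D.bdry n → ℂ) (z : Cn n) : ℂ :=
  ∫ ξ, D.cauchy z (ξ : Cn n) * g ξ ∂σ

/-- The kernel `k_b(z, w) = (1 - b(z) conj b(w)) C(z, w)`. -/
def kb (D : Dom) {n : ℕ} (b : Cn n → ℂ) (z w : Cn n) : ℂ :=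
  (1 - b z * conj (b w)) * D.cauchy z w

/-- The kernel `k_b` on `Ω × Ω`, each value being read as a multiplication operator on `ℂ`. -/
def kbMatrix (D : Dom) {n : ℕ} (b : Cn n → ℂ) :
    Matrix (D.region n) (D.region n) (ℂ →L[ℂ] ℂ) :=
  Matrix.of fun z w => kb D b z w • ContinuousLinearMap.id ℂ ℂ

/-- The de Branges--Rovnyak space `ℋ(b)`: the Hilbert space of functions on `Ω` with reproducing
kernel `k_b` (for a positive semidefinite kernel). -/
abbrev DBR (D : Dom) {n : ℕ} (b : Cn n → ℂ) [Fact (kbMatrix D b).PosSemidef] : Type :=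
  RKHS.OfKernel (kbMatrix D b)

/-- The element `k_w = k_b(·, w)` of `ℋ(b)`. -/
def kbElem (D : Dom) {n : ℕ} (b : Cn n → ℂ) [Fact (kbMatrix D b).PosSemidef] (w : D.region n) :
    DBR D b :=
  RKHS.kerFun (DBR D b) w (1 : ℂ)

theorem kbElem_apply (D : Dom) {n : ℕ} (b : Cn n → ℂ) [Fact (kbMatrix D b).PosSemidef]
    (z w : D.region n) : kbElem D b w z = kb D b z w := by
  have h := RKHS.kerFun_apply (H := DBR D b) w (1 : ℂ) z
  rw [RKHS.OfKernel.kernel_ofKernel] at h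
  refine h.trans ?_
  simp [kbMatrix]

theorem isCompact_bdry (D : Dom) (n : ℕ) : IsCompact (D.bdry n) := by
  cases D with
  | ball =>
    have : Dom.ball.bdry n = Metric.sphere (0 : Cn n) 1 := by
      ext z; simp [Dom.bdry]
    rw [this]
    exact isCompact_sphere _ _
  | polydisc =>
    refine Metric.isCompact_of_isClosed_isBounded ?_ ?_
    · have : Dom.polydisc.bdry n = ⋂ j, {z : Cn n | ‖z j‖ = 1} := by
        ext z; simp [Dom.bdry]
      rw [this]
      exact isClosed_iInter fun j => isClosed_eq (by fun_prop) continuous_const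
    · refine (Metric.isBounded_closedBall (x := (0 : Cn n)) (r := √n)).subset fun z hz => ?_
      have hz' : ∀ j, ‖z j‖ = 1 := hz
      simp [EuclideanSpace.norm_eq, hz']

theorem one_sub_ne_zero_of_norm_lt {a : ℂ} (h : ‖a‖ < 1) : 1 - a ≠ 0 := by
  intro h0
  rw [← sub_eq_zero.mp h0] at h
  simp at h

theorem continuous_cauchy (D : Dom) {n : ℕ} {w : Cn n} (hw : w ∈ D.region n) :
    Continuous fun ζ : D.bdry n => D.cauchy (ζ : Cn n) w := by
  cases D with
  | ball =>
    have hw' : ‖w‖ < 1 := hw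
    refine Continuous.div continuous_const (by fun_prop) fun ζ => pow_ne_zero _ ?_
    have hζ : ‖(ζ : Cn n)‖ = 1 := ζ.2
    refine one_sub_ne_zero_of_norm_lt ?_
    have h1 : ∑ j, (ζ : Cn n) j * conj (w j) = inner ℂ w (ζ : Cn n) := by
      simp [PiLp.inner_apply]
    rw [h1]
    refine (norm_inner_le_norm (𝕜 := ℂ) w (ζ : Cn n)).trans_lt ?_
    rw [hζ, mul_one]
    exact hw'
  | polydisc =>
    have hw' : ∀ j, ‖w j‖ < 1 := hw
    refine continuous_finsetProd _ fun j _ =>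
      Continuous.div continuous_const (by fun_prop) fun ζ => ?_
    have hζ : ∀ j, ‖(ζ : Cn n) j‖ = 1 := ζ.2
    refine one_sub_ne_zero_of_norm_lt ?_
    rw [norm_mul, hζ, one_mul, RCLike.norm_conj]
    exact hw' j

theorem memLp_cauchy (D : Dom) {n : ℕ} (σ : Measure (D.bdry n)) [IsFiniteMeasure σ]
    (w : D.region n) : MemLp (fun ζ : D.bdry n => D.cauchy (ζ : Cn n) (w : Cn n)) 2 σ := by
  have hc := continuous_cauchy D w.2
  have : CompactSpace (D.bdry n) := isCompact_iff_compactSpace.mp (isCompact_bdry D n)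
  obtain ⟨M, hM⟩ := (isCompact_univ (X := D.bdry n)).exists_bound_of_continuousOn hc.continuousOn
  exact MemLp.of_bound hc.aestronglyMeasurable M (.of_forall fun ζ => hM ζ (Set.mem_univ ζ))

/-- The function `C(·, w)`, `w ∈ Ω`, as an element of `L²(σ)`. -/
def cauchyLp (D : Dom) {n : ℕ} (σ : Measure (D.bdry n)) [IsFiniteMeasure σ] (w : D.region n) :
    Lp ℂ 2 σ :=
  (memLp_cauchy D σ w).toLp

/-- The closed linear span of a subset of a complex Hilbert space. -/
abbrev closedSpan {E : Type*} [NormedAddCommGroup E] [InnerProductSpace ℂ E] (s : Set E) :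
    Submodule ℂ E :=
  (Submodule.span ℂ s).topologicalClosure

/-- `H²(σ)`: the closed linear span of the functions `C(·, w)`, `w ∈ Ω`, in `L²(σ)`. -/
abbrev H2 (D : Dom) {n : ℕ} (σ : Measure (D.bdry n)) [IsFiniteMeasure σ] :=
  closedSpan (Set.range (cauchyLp D σ))

theorem cauchyLp_mem_H2 (D : Dom) {n : ℕ} (σ : Measure (D.bdry n)) [IsFiniteMeasure σ]
    (w : D.region n) : cauchyLp D σ w ∈ H2 D σ :=
  Submodule.le_topologicalClosure _ (Submodule.subset_span ⟨w, rfl⟩)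

/-- The function `C(·, w)`, `w ∈ Ω`, as an element of `H²(σ)`. -/
def cauchyH2 (D : Dom) {n : ℕ} (σ : Measure (D.bdry n)) [IsFiniteMeasure σ] (w : D.region n) :
    H2 D σ :=
  ⟨cauchyLp D σ w, cauchyLp_mem_H2 D σ w⟩

/-- A partial isometry of Hilbert spaces: isometric on the orthogonal complement of its kernel. -/
def IsPartialIsometry {E F : Type*} [NormedAddCommGroup E] [InnerProductSpace ℂ E]
    [NormedAddCommGroup F] [InnerProductSpace ℂ F] (V : E →L[ℂ] F) : Prop :=
  ∀ g ∈ (LinearMap.ker (V : E →ₗ[ℂ] F))ᗮ, ‖V g‖ = ‖g‖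

end ClarkSeveral

end

/-! Multiplied by `|1 - ᾱ b(z)|² C(z, z)`, the Poisson identity for the Clark measure reads `k_b(z,
z) = |1 - ᾱ b(z)|² ∫ |C(z, ζ)|² dσ(ζ)`. Both sides are diagonal values of kernels holomorphic in `z`
and antiholomorphic in `w`, so polarization extends the equality to all pairs
(`kb_eq_mul_integral`). Thus `k_b` is the Gram matrix of the vectors `(1 - α conj b(w)) C(·, w)`,
which are total in `H²(σ)` since the scalars do not vanish.

Everything else is Hilbert space theory. A Gram matrix is positive semidefinite, and two total
families with equal Gram matrices are matched by a unitary
(`exists_linearIsometryEquiv_of_inner_eq`), here `U`. The operator `V` is `U⁻¹ = U*` composed with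
the orthogonal projection onto `H²(σ)`; pairing with `k_z` turns it into the Cauchy integral
formula. -/

namespace ClarkSeveral

open Filter Topology

/-! ### One complex variable: parameter integrals and the identity theorem. -/

/-- Integrals over a compact space of a continuous family of holomorphic functions are
holomorphic. -/
theorem differentiableOn_integral_of_continuousOn {X : Type*} [TopologicalSpace X] [CompactSpace X]
    [MeasurableSpace X] [OpensMeasurableSpace X] (μ : Measure X) [IsFiniteMeasure μ]
    {U : Set ℂ} (hU : IsOpen U) {Φ : ℂ → X → ℂ}
    (hc : ContinuousOn (Function.uncurry Φ) (U ×ˢ Set.univ))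
    (hd : ∀ ζ, DifferentiableOn ℂ (fun s => Φ s ζ) U) :
    DifferentiableOn ℂ (fun s => ∫ ζ, Φ s ζ ∂μ) U := by
  intro s₀ hs₀
  obtain ⟨ε, hε, hεU⟩ := Metric.isOpen_iff.1 hU s₀ hs₀
  -- Radius `2 * r` leaves room for circles of radius `r` around every point of `ball s₀ r`, as the
  -- Cauchy estimate requires.
  obtain ⟨r, hr, hrε⟩ : ∃ r : ℝ, 0 < r ∧ 2 * r < ε := ⟨ε / 3, by positivity, by linarith⟩
  have hball : Metric.closedBall s₀ (2 * r) ⊆ U :=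
    (Metric.closedBall_subset_ball hrε).trans hεU
  obtain ⟨M, hM⟩ := ((isCompact_closedBall s₀ (2 * r)).prod
    (isCompact_univ (X := X))).exists_bound_of_continuousOn
    (hc.mono (Set.prod_mono hball subset_rfl))
  have hsub : ∀ s ∈ Metric.ball s₀ r, Metric.closedBall s r ⊆ Metric.closedBall s₀ (2 * r) := by
    intro s hs
    refine Metric.closedBall_subset_closedBall' ?_
    have := Metric.mem_ball.1 hs
    linarith
  have hcont : ∀ s ∈ U, Continuous (Φ s) := by
    intro s hs
    have h := hc.comp_continuous (f := fun ζ : X => (s, ζ)) (by fun_prop) fun ζ => ⟨hs, trivial⟩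
    exact h
  have hdat : ∀ s ∈ Metric.ball s₀ r, ∀ ζ,
      HasDerivAt (fun s => Φ s ζ) (deriv (fun s => Φ s ζ) s) s := fun s hs ζ =>
    ((hd ζ).differentiableAt (hU.mem_nhds
      (hball (hsub s hs (Metric.mem_closedBall_self hr.le))))).hasDerivAt
  have hs₀b : s₀ ∈ Metric.ball s₀ r := Metric.mem_ball_self hr
  refine (hasDerivAt_integral_of_dominated_loc_of_deriv_le
    (F' := fun s ζ => deriv (fun s => Φ s ζ) s) (bound := fun _ => M / r)
    (Metric.ball_mem_nhds s₀ hr) ?_ ?_ ?_ ?_ (integrable_const _)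
    (.of_forall fun ζ s hs => hdat s hs ζ)).2.differentiableAt.differentiableWithinAt
  · filter_upwards [hU.mem_nhds hs₀] with s hs
    exact (hcont s hs).aestronglyMeasurable
  · refine Integrable.of_bound (hcont s₀ hs₀).aestronglyMeasurable M (.of_forall fun ζ => ?_)
    exact hM (s₀, ζ) ⟨Metric.mem_closedBall_self (by positivity), trivial⟩
  -- The derivative is measurable in `ζ` as a pointwise limit of difference quotients, each
  -- continuous in `ζ`.
  · have hseq : Tendsto (fun k : ℕ => ((r / (k + 2) : ℝ) : ℂ)) atTop (𝓝[≠] 0) := by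
      refine tendsto_nhdsWithin_iff.2 ⟨?_, .of_forall fun k => ?_⟩
      · rw [← Complex.ofReal_zero]
        refine (Complex.continuous_ofReal.tendsto 0).comp ?_
        exact tendsto_const_nhds.div_atTop (tendsto_natCast_atTop_atTop.atTop_add
          tendsto_const_nhds)
      · have : (0 : ℝ) < r / (k + 2) := by positivity
        exact Complex.ofReal_ne_zero.2 this.ne'
    refine aestronglyMeasurable_of_tendsto_ae atTop
      (f := fun (k : ℕ) ζ => ((r / (k + 2) : ℝ) : ℂ)⁻¹ •
        (Φ (s₀ + ((r / (k + 2) : ℝ) : ℂ)) ζ - Φ s₀ ζ)) (fun k => ?_)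
      (.of_forall fun ζ => (hdat s₀ hs₀b ζ).tendsto_slope_zero.comp hseq)
    have hmem : s₀ + ((r / (k + 2) : ℝ) : ℂ) ∈ U := hball ?_
    · have hk := hcont _ hmem
      have h0 := hcont s₀ hs₀
      exact Continuous.aestronglyMeasurable (by fun_prop)
    rw [Metric.mem_closedBall, dist_eq_norm, add_sub_cancel_left, Complex.norm_real,
      Real.norm_of_nonneg (by positivity), div_le_iff₀ (by positivity)]
    nlinarith [(Nat.cast_nonneg k : (0 : ℝ) ≤ k)]
  · refine .of_forall fun ζ s hs => ?_
    refine Complex.norm_deriv_le_of_forall_mem_sphere_norm_le hr ?_ fun t ht =>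
      hM (t, ζ) ⟨hsub s hs (Metric.sphere_subset_closedBall ht), trivial⟩
    refine DifferentiableOn.diffContOnCl ?_
    rw [closure_ball _ hr.ne']
    exact (hd ζ).mono ((hsub s hs).trans hball)

/-- The identity theorem for functions of one complex variable vanishing on the imaginary axis
near the origin. -/
theorem eqOn_zero_of_imaginary {U : Set ℂ} (hU : IsOpen U) (hU' : Convex ℝ U) (h0 : 0 ∈ U)
    {h : ℂ → ℂ} (hd : DifferentiableOn ℂ h U) (hz : ∀ s ∈ U, conj s = -s → h s = 0) :
    Set.EqOn h 0 U := by
  refine (hd.analyticOnNhd hU).eqOn_zero_of_preconnected_of_frequently_eq_zero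
    hU'.isPreconnected h0 ?_
  have ht : Tendsto (fun t : ℝ => (t : ℂ) * Complex.I) (𝓝[≠] 0) (𝓝[≠] 0) := by
    refine tendsto_nhdsWithin_iff.2 ⟨?_, ?_⟩
    · have : Continuous fun t : ℝ => (t : ℂ) * Complex.I := by fun_prop
      simpa using (this.tendsto 0).mono_left nhdsWithin_le_nhds
    · filter_upwards [self_mem_nhdsWithin] with t ht
      simpa using ht
  refine ht.frequently (Eventually.frequently ?_)
  filter_upwards [ht.eventually (mem_nhdsWithin_of_mem_nhds (hU.mem_nhds h0))] with t ht
  exact hz _ ht (by simp)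

/-! ### Geometry of the domains and regularity of the Cauchy kernel. -/

theorem Dom.isOpen_region (D : Dom) (n : ℕ) : IsOpen (D.region n) := by
  cases D with
  | ball => exact isOpen_lt continuous_norm continuous_const
  | polydisc =>
    have : Dom.polydisc.region n = ⋂ j, {z : Cn n | ‖z j‖ < 1} := by
      ext z; simp [Dom.region]
    rw [this]
    exact isOpen_iInter_of_finite fun j => isOpen_lt (by fun_prop) continuous_const

theorem Dom.convex_region (D : Dom) (n : ℕ) : Convex ℝ (D.region n) := by
  cases D with
  | ball =>
    have : Dom.ball.region n = Metric.ball (0 : Cn n) 1 := by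
      ext z; simp [Dom.region]
    rw [this]
    exact convex_ball _ _
  | polydisc =>
    intro z hz w hw s t hs ht hst j
    have := convex_ball (0 : ℂ) 1 (mem_ball_zero_iff.2 (hz j)) (mem_ball_zero_iff.2 (hw j))
      hs ht hst
    simpa using this

/-- Pairs of points at which the Cauchy kernel is regular. -/
def Dom.Regular (D : Dom) {n : ℕ} (z ζ : Cn n) : Prop :=
  match D with
  | .ball => ‖z‖ * ‖ζ‖ < 1
  | .polydisc => ∀ j, ‖z j‖ * ‖ζ j‖ < 1

theorem Dom.Regular.symm {D : Dom} {n : ℕ} {z ζ : Cn n} (h : D.Regular z ζ) : D.Regular ζ z := by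
  cases D with
  | ball => exact (mul_comm _ _).trans_lt h
  | polydisc => exact fun j => (mul_comm _ _).trans_lt (h j)

theorem Dom.regular_of_mem_region {D : Dom} {n : ℕ} {z ζ : Cn n} (hz : z ∈ D.region n)
    (hζ : ζ ∈ D.region n ∪ D.bdry n) : D.Regular z ζ := by
  cases D with
  | ball =>
    have h1 : ‖z‖ < 1 := hz
    have h2 : ‖ζ‖ ≤ 1 := hζ.elim (fun h => le_of_lt h) (fun h => le_of_eq h)
    exact (mul_le_of_le_one_right (norm_nonneg _) h2).trans_lt h1
  | polydisc =>
    intro j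
    have h1 : ‖z j‖ < 1 := hz j
    have h2 : ‖ζ j‖ ≤ 1 := hζ.elim (fun h => le_of_lt (h j)) (fun h => le_of_eq (h j))
    exact (mul_le_of_le_one_right (norm_nonneg _) h2).trans_lt h1

theorem one_sub_sum_ne_zero {n : ℕ} {z ζ : Cn n} (h : ‖z‖ * ‖ζ‖ < 1) :
    1 - ∑ j, z j * conj (ζ j) ≠ 0 := by
  refine one_sub_ne_zero_of_norm_lt ?_
  have h1 : ∑ j, z j * conj (ζ j) = inner ℂ ζ z := by simp [PiLp.inner_apply]
  rw [h1]
  exact (norm_inner_le_norm ζ z).trans_lt ((mul_comm _ _).trans_lt h)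

theorem one_sub_mul_conj_ne_zero {z ζ : ℂ} (h : ‖z‖ * ‖ζ‖ < 1) : 1 - z * conj ζ ≠ 0 :=
  one_sub_ne_zero_of_norm_lt (by rwa [norm_mul, RCLike.norm_conj])

theorem Dom.Regular.cauchy_ne_zero {D : Dom} {n : ℕ} {z ζ : Cn n} (h : D.Regular z ζ) :
    D.cauchy z ζ ≠ 0 := by
  cases D with
  | ball => exact div_ne_zero one_ne_zero (pow_ne_zero _ (one_sub_sum_ne_zero h))
  | polydisc => exact Finset.prod_ne_zero_iff.2 fun j _ =>
      div_ne_zero one_ne_zero (one_sub_mul_conj_ne_zero (h j))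

theorem Dom.conj_cauchy (D : Dom) {n : ℕ} (z ζ : Cn n) :
    conj (D.cauchy z ζ) = D.cauchy ζ z := by
  cases D <;> simp [Dom.cauchy, mul_comm]

theorem Dom.Regular.continuousAt_cauchy {D : Dom} {n : ℕ} {X : Type*} [TopologicalSpace X]
    {f g : X → Cn n} {p : X} (h : D.Regular (f p) (g p)) (hf : ContinuousAt f p)
    (hg : ContinuousAt g p) : ContinuousAt (fun p => D.cauchy (f p) (g p)) p := by
  cases D with
  | ball =>
    exact ContinuousAt.div continuousAt_const (by fun_prop)
      (pow_ne_zero _ (one_sub_sum_ne_zero h))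
  | polydisc =>
    refine tendsto_finsetProd _ fun j _ => ?_
    exact ContinuousAt.div continuousAt_const (by fun_prop) (one_sub_mul_conj_ne_zero (h j))

theorem Dom.Regular.differentiableAt_cauchy {D : Dom} {n : ℕ} {f g : ℂ → Cn n} {s : ℂ}
    (h : D.Regular (f s) (g s)) (hf : ∀ j, DifferentiableAt ℂ (fun s => f s j) s)
    (hg : ∀ j, DifferentiableAt ℂ (fun s => conj (g s j)) s) :
    DifferentiableAt ℂ (fun s => D.cauchy (f s) (g s)) s := by
  cases D with
  | ball =>
    exact DifferentiableAt.div (differentiableAt_const _) (by fun_prop)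
      (pow_ne_zero _ (one_sub_sum_ne_zero h))
  | polydisc =>
    refine DifferentiableAt.fun_finsetProd fun j _ => ?_
    exact DifferentiableAt.div (differentiableAt_const _) (by fun_prop)
      (one_sub_mul_conj_ne_zero (h j))

/-! ### Polarization of the Clark identity. -/

/-- Since `|α| = 1`, the factor in front equals `|α - β|²`, which clears the denominator of the real
part. -/
theorem norm_sq_one_sub_mul_re {α β : ℂ} (hα : ‖α‖ = 1) (hβ : ‖β‖ < 1) :
    (1 - conj α * β) * (1 - α * conj β) * (((α + β) / (α - β)).re : ℂ) = 1 - β * conj β := by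
  have hαα : α * conj α = 1 := by simp [Complex.mul_conj', hα]
  have hne : α - β ≠ 0 := by
    intro h
    rw [← sub_eq_zero.1 h, hα] at hβ
    exact lt_irrefl _ hβ
  have hne' : conj α - conj β ≠ 0 := by
    rw [← map_sub]
    exact (map_ne_zero _).2 hne
  have h1 : (1 - conj α * β) * (1 - α * conj β) = (α - β) * (conj α - conj β) := by
    linear_combination (β * conj β - 1) * hαα
  rw [Complex.re_eq_add_conj, h1]
  simp only [map_div₀, map_add, map_sub]
  field_simp
  linear_combination 2 * hαα

/-- The kernel is antiholomorphic in its second argument, hence the condition on the conjugate of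
`q`. -/
theorem differentiableOn_integral_cauchy_mul_cauchy {D : Dom} {n : ℕ} (σ : Measure (D.bdry n))
    [IsFiniteMeasure σ] {U : Set ℂ} (hU : IsOpen U) {p q : ℂ → Cn n} (hp : Continuous p)
    (hq : Continuous q) (hpU : ∀ s ∈ U, p s ∈ D.region n) (hqU : ∀ s ∈ U, q s ∈ D.region n)
    (hpd : ∀ s j, DifferentiableAt ℂ (fun s => p s j) s)
    (hqd : ∀ s j, DifferentiableAt ℂ (fun s => conj (q s j)) s) :
    DifferentiableOn ℂ (fun s => ∫ ζ : D.bdry n, D.cauchy (p s) ζ * D.cauchy ζ (q s) ∂σ) U := by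
  have : CompactSpace (D.bdry n) := isCompact_iff_compactSpace.mp (isCompact_bdry D n)
  have hreg1 : ∀ s ∈ U, ∀ ζ : D.bdry n, D.Regular (p s) ζ := fun s hs ζ =>
    Dom.regular_of_mem_region (hpU s hs) (.inr ζ.2)
  have hreg2 : ∀ s ∈ U, ∀ ζ : D.bdry n, D.Regular (ζ : Cn n) (q s) := fun s hs ζ =>
    (Dom.regular_of_mem_region (hqU s hs) (.inr ζ.2)).symm
  refine differentiableOn_integral_of_continuousOn σ hU ?_ fun ζ s hs => ?_
  · rintro ⟨s, ζ⟩ ⟨hs, -⟩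
    have h1 : ContinuousAt (fun r : ℂ × D.bdry n => D.cauchy (p r.1) r.2) (s, ζ) :=
      Dom.Regular.continuousAt_cauchy (p := (s, ζ)) (hreg1 s hs ζ) (by fun_prop) (by fun_prop)
    have h2 : ContinuousAt (fun r : ℂ × D.bdry n => D.cauchy r.2 (q r.1)) (s, ζ) :=
      Dom.Regular.continuousAt_cauchy (p := (s, ζ)) (hreg2 s hs ζ) (by fun_prop) (by fun_prop)
    exact (h1.mul h2).continuousWithinAt
  · refine DifferentiableAt.differentiableWithinAt (DifferentiableAt.mul ?_ ?_)
    · exact Dom.Regular.differentiableAt_cauchy (g := fun _ => (ζ : Cn n)) (hreg1 s hs ζ) (hpd s)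
        fun j => differentiableAt_const _
    · exact Dom.Regular.differentiableAt_cauchy (f := fun _ => (ζ : Cn n)) (hreg2 s hs ζ)
        (fun j => differentiableAt_const _) (hqd s)

/-- The reproducing formula `k_b(z, w) = (1 - ᾱ b(z)) (1 - α conj b(w)) ∫ C(z, ζ) C(ζ, w) dσ(ζ)`. -/
theorem kb_eq_mul_integral {D : Dom} {n : ℕ} {b : Cn n → ℂ}
    (hb : DifferentiableOn ℂ b (D.region n)) (hb_lt : ∀ z ∈ D.region n, ‖b z‖ < 1)
    {α : ℂ} (hα : ‖α‖ = 1) {σ : Measure (D.bdry n)} [IsFiniteMeasure σ]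
    (hσ : IsClarkMeasure D b α σ) {z w : Cn n} (hz : z ∈ D.region n) (hw : w ∈ D.region n) :
    kb D b z w = (1 - conj α * b z) * (1 - α * conj (b w)) *
      ∫ ζ : D.bdry n, D.cauchy z ζ * D.cauchy ζ w ∂σ := by
  have hdiag : ∀ u ∈ D.region n, kb D b u u = (1 - conj α * b u) * (1 - α * conj (b u)) *
      ∫ ζ : D.bdry n, D.cauchy u ζ * D.cauchy ζ u ∂σ := by
    intro u hu
    have hC := (Dom.regular_of_mem_region hu (.inl hu)).cauchy_ne_zero
    have h1 := hσ u hu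
    simp only [Dom.poisson, integral_div] at h1
    rw [div_eq_iff hC] at h1
    rw [h1, ← mul_assoc, norm_sq_one_sub_mul_re hα (hb_lt u hu), kb]
  -- The complex line for polarization: `(p, q)` equals `(z, w)` at `s = 1`, while `p = q` wherever
  -- `conj s = -s`. Both `p` and `conj ∘ q` are holomorphic in `s`, so the diagonal identity on the
  -- imaginary axis propagates to `s = 1`.
  let x : Cn n := (2⁻¹ : ℂ) • (z + w)
  let y : Cn n := (2⁻¹ : ℂ) • (z - w)
  let p : ℂ → Cn n := fun s => x + s • y
  let q : ℂ → Cn n := fun s => x - conj s • y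
  have hp : Continuous p := by fun_prop
  have hq : Continuous q := by
    have : Continuous (fun s : ℂ => conj s) := Complex.continuous_conj
    fun_prop
  let U : Set ℂ := p ⁻¹' D.region n ∩ q ⁻¹' D.region n
  have hU : IsOpen U := ((D.isOpen_region n).preimage hp).inter ((D.isOpen_region n).preimage hq)
  have hUc : Convex ℝ U := by
    -- Conjugation is real-linear, so `p` and `q` are both real-affine and pull convex sets back to
    -- convex sets.
    have hcomb : ∀ (s t : ℂ) (a c : ℝ), a + c = 1 →
        p (a • s + c • t) = a • p s + c • p t ∧ q (a • s + c • t) = a • q s + c • q t := by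
      intro s t a c hac
      have hac' : (a : ℂ) + c = 1 := by exact_mod_cast hac
      constructor <;> ext j
      · simp [p]
        linear_combination (-(x j)) * hac'
      · simp [q]
        linear_combination (-(x j)) * hac'
    intro s hs t ht a c ha hc hac
    refine ⟨?_, ?_⟩
    · rw [Set.mem_preimage, (hcomb s t a c hac).1]
      exact D.convex_region n hs.1 ht.1 ha hc hac
    · rw [Set.mem_preimage, (hcomb s t a c hac).2]
      exact D.convex_region n hs.2 ht.2 ha hc hac
  have hp1 : p 1 = z := by ext j; simp [p, x, y]; ring
  have hq1 : q 1 = w := by ext j; simp [q, x, y]; ring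
  have h1U : (1 : ℂ) ∈ U := ⟨by rwa [Set.mem_preimage, hp1], by rwa [Set.mem_preimage, hq1]⟩
  have h0U : (0 : ℂ) ∈ U := by
    have hx : x ∈ D.region n := by
      have := D.convex_region n hz hw (a := 2⁻¹) (b := 2⁻¹) (by norm_num) (by norm_num)
        (by norm_num)
      convert this using 1
      ext j; simp [x]
    constructor <;> simpa [p, q] using hx
  have hpd : ∀ s j, DifferentiableAt ℂ (fun s => p s j) s := by
    intro s j
    simp only [p, PiLp.add_apply, PiLp.smul_apply, smul_eq_mul]
    fun_prop
  have hqd : ∀ s j, DifferentiableAt ℂ (fun s => conj (q s j)) s := by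
    intro s j
    simp only [q, PiLp.sub_apply, PiLp.smul_apply, smul_eq_mul, map_sub, map_mul,
      Complex.conj_conj]
    fun_prop
  have hbp : DifferentiableOn ℂ (fun s => b (p s)) U := fun s hs =>
    ((hb.differentiableAt ((D.isOpen_region n).mem_nhds hs.1)).comp s
      (by fun_prop)).differentiableWithinAt
  have hbq : DifferentiableOn ℂ (fun s => conj (b (q s))) U := by
    intro s hs
    have h1 : DifferentiableAt ℂ (fun t : ℂ => b (x - t • y)) (conj s) :=
      (hb.differentiableAt ((D.isOpen_region n).mem_nhds hs.2)).comp (conj s)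
        (f := fun t : ℂ => x - t • y) (by fun_prop)
    have h2 := h1.conj_conj
    rw [Complex.conj_conj] at h2
    exact h2.differentiableWithinAt
  have hint := differentiableOn_integral_cauchy_mul_cauchy σ hU hp hq (fun s hs => hs.1)
    (fun s hs => hs.2) hpd hqd
  have hC : DifferentiableOn ℂ (fun s => D.cauchy (p s) (q s)) U := fun s hs =>
    ((Dom.regular_of_mem_region hs.1 (.inl hs.2)).differentiableAt_cauchy (hpd s)
      (hqd s)).differentiableWithinAt
  have hzero := eqOn_zero_of_imaginary hU hUc h0U
    (h := fun s => kb D b (p s) (q s) - (1 - conj α * b (p s)) * (1 - α * conj (b (q s))) *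
      ∫ ζ : D.bdry n, D.cauchy (p s) ζ * D.cauchy ζ (q s) ∂σ) ?_ ?_ h1U
  · simpa only [hp1, hq1, Pi.zero_apply, sub_eq_zero] using hzero
  · exact (((hbp.mul hbq).const_sub 1).mul hC).sub
      ((((hbp.const_mul (conj α)).const_sub 1).mul ((hbq.const_mul α).const_sub 1)).mul hint)
  · intro s hs hs'
    have hpq : q s = p s := by simp [p, q, hs', sub_eq_add_neg]
    simp only [hpq]
    exact sub_eq_zero.2 (hdiag _ hs.1)

/-! ### Gram matrices, unitary equivalence and positivity. -/

theorem denseRange_linearCombination_of_inner_eq_zero {ι E : Type*} [NormedAddCommGroup E]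
    [InnerProductSpace ℂ E] [CompleteSpace E] {u : ι → E}
    (hu : ∀ x, (∀ i, ⟪u i, x⟫_ℂ = 0) → x = 0) : DenseRange (Finsupp.linearCombination ℂ u) := by
  have h : (LinearMap.range (Finsupp.linearCombination ℂ u)).topologicalClosure = ⊤ := by
    rw [Submodule.topologicalClosure_eq_top_iff, Submodule.eq_bot_iff]
    refine fun x hx => hu x fun i => ?_
    refine Submodule.inner_right_of_mem_orthogonal ?_ hx
    exact ⟨Finsupp.single i 1, by simp⟩
  rw [← Submodule.dense_iff_topologicalClosure_eq_top] at h
  rwa [LinearMap.coe_range] at h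

/-- Two total families with the same Gram matrix are unitarily equivalent. -/
theorem exists_linearIsometryEquiv_of_inner_eq {ι E F : Type*} [NormedAddCommGroup E]
    [InnerProductSpace ℂ E] [CompleteSpace E] [NormedAddCommGroup F] [InnerProductSpace ℂ F]
    [CompleteSpace F] {u : ι → E} {v : ι → F} (h : ∀ i j, ⟪u i, u j⟫_ℂ = ⟪v i, v j⟫_ℂ)
    (hu : ∀ x, (∀ i, ⟪u i, x⟫_ℂ = 0) → x = 0) (hv : ∀ x, (∀ i, ⟪v i, x⟫_ℂ = 0) → x = 0) :
    ∃ U : E ≃ₗᵢ[ℂ] F, ∀ i, U (u i) = v i := by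
  have hnorm : ∀ c : ι →₀ ℂ, ‖Finsupp.linearCombination ℂ v (LinearEquiv.refl ℂ (ι →₀ ℂ) c)‖ =
      ‖Finsupp.linearCombination ℂ u c‖ := by
    intro c
    have hin : ⟪Finsupp.linearCombination ℂ v c, Finsupp.linearCombination ℂ v c⟫_ℂ =
        ⟪Finsupp.linearCombination ℂ u c, Finsupp.linearCombination ℂ u c⟫_ℂ := by
      simp only [Finsupp.linearCombination_apply, Finsupp.sum_inner, Finsupp.inner_sum,
        inner_smul_left, inner_smul_right, h]
    rw [LinearEquiv.refl_apply, norm_eq_sqrt_re_inner (𝕜 := ℂ), hin,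
      ← norm_eq_sqrt_re_inner (𝕜 := ℂ)]
  -- Formal combinations map to dense subspaces on both sides with equal norms, so no linear
  -- independence is needed.
  refine ⟨(LinearEquiv.refl ℂ (ι →₀ ℂ)).extendOfIsometry (Finsupp.linearCombination ℂ u)
    (Finsupp.linearCombination ℂ v) (denseRange_linearCombination_of_inner_eq_zero hu)
    (denseRange_linearCombination_of_inner_eq_zero hv) hnorm, fun i => ?_⟩
  have := LinearEquiv.extendOfIsometry_eq (LinearEquiv.refl ℂ (ι →₀ ℂ))
    (Finsupp.linearCombination ℂ u) (Finsupp.linearCombination ℂ v)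
    (denseRange_linearCombination_of_inner_eq_zero hu)
    (denseRange_linearCombination_of_inner_eq_zero hv) hnorm (Finsupp.single i 1)
  simpa using this

/-- A kernel that is the Gram matrix of a family in a Hilbert space is positive semidefinite. -/
theorem posSemidef_kbMatrix_of_inner_eq {D : Dom} {n : ℕ} {b : Cn n → ℂ} {E : Type*}
    [NormedAddCommGroup E] [InnerProductSpace ℂ E] {e : D.region n → E}
    (he : ∀ z w : D.region n, ⟪e z, e w⟫_ℂ = kb D b z w) : (kbMatrix D b).PosSemidef := by
  have key := (RKHS.posSemidef_tfae (K := kbMatrix D b)).out 0 2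
  refine key.2 ⟨?_, ?_⟩
  · refine Matrix.IsHermitian.ext fun z w => ?_
    rw [kbMatrix, Matrix.of_apply, Matrix.of_apply, star_smul, ← he, ← he, RCLike.star_def,
      inner_conj_symm]
    exact congrArg _ (star_one (ℂ →L[ℂ] ℂ))
  · intro c
    -- The quadratic form of the kernel is the squared norm of a combination of the `e x`.
    have : (c.sum fun x w => c.sum fun x' w' => ⟪kbMatrix D b x' x w, w'⟫_ℂ) =
        ⟪c.sum fun x w => w • e x, c.sum fun x w => w • e x⟫_ℂ := by
      rw [Finsupp.sum_inner]
      refine Finsupp.sum_congr fun x _ => ?_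
      rw [Finsupp.inner_sum]
      refine Finsupp.sum_congr fun y _ => ?_
      simp [kbMatrix, ← he, inner_smul_left, inner_smul_right, mul_comm]
    rw [this]
    exact inner_self_nonneg

/-! ### Evaluation by inner products, totality, and partial isometries. -/

section

variable {D : Dom} {n : ℕ} {b : Cn n → ℂ}

theorem inner_kbElem [Fact (kbMatrix D b).PosSemidef] (z : D.region n) (f : DBR D b) :
    ⟪kbElem D b z, f⟫_ℂ = f z := by
  rw [kbElem, RKHS.kerFun_inner]
  simp

theorem eq_zero_of_inner_kbElem [Fact (kbMatrix D b).PosSemidef] (f : DBR D b)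
    (h : ∀ z, ⟪kbElem D b z, f⟫_ℂ = 0) : f = 0 :=
  RKHS.ext fun z => by rw [← inner_kbElem, h]; simp

theorem inner_cauchyLp_left (σ : Measure (D.bdry n)) [IsFiniteMeasure σ] (z : D.region n)
    (g : Lp ℂ 2 σ) : ⟪cauchyLp D σ z, g⟫_ℂ = cauchyTransform D σ g z := by
  rw [L2.inner_def, cauchyTransform]
  refine integral_congr_ae ?_
  filter_upwards [(memLp_cauchy D σ z).coeFn_toLp] with ζ hζ
  rw [cauchyLp, hζ, RCLike.inner_apply, D.conj_cauchy, mul_comm]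

theorem eq_zero_of_inner_cauchyH2 (σ : Measure (D.bdry n)) [IsFiniteMeasure σ]
    (x : H2 D σ) (h : ∀ z, ⟪cauchyH2 D σ z, x⟫_ℂ = 0) : x = 0 := by
  have hx : (x : Lp ℂ 2 σ) ∈ (H2 D σ)ᗮ := by
    rw [Submodule.orthogonal_closure]
    refine Submodule.mem_orthogonal _ _ |>.2 fun u hu => ?_
    induction hu using Submodule.span_induction with
    | mem u hu => obtain ⟨z, rfl⟩ := hu; exact h z
    | zero => simp
    | add u v _ _ hu hv => rw [inner_add_left, hu, hv, add_zero]
    | smul c u _ hu => rw [inner_smul_left, hu, mul_zero]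
  have := Submodule.inner_right_of_mem_orthogonal x.2 hx
  exact Subtype.ext (inner_self_eq_zero.1 this)

theorem inner_cauchyLp_cauchyLp (σ : Measure (D.bdry n)) [IsFiniteMeasure σ]
    (z w : D.region n) : ⟪cauchyLp D σ z, cauchyLp D σ w⟫_ℂ =
      ∫ ζ : D.bdry n, D.cauchy (z : Cn n) ζ * D.cauchy ζ (w : Cn n) ∂σ := by
  rw [inner_cauchyLp_left, cauchyTransform]
  refine integral_congr_ae ?_
  filter_upwards [(memLp_cauchy D σ w).coeFn_toLp] with ζ hζ
  rw [cauchyLp, hζ]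

/-- The kernel contains `Kᗮ`, so its orthogonal complement lies in `K`, where the projection is the
identity. -/
theorem isPartialIsometry_comp_orthogonalProjectionOnto {E F : Type*} [NormedAddCommGroup E]
    [InnerProductSpace ℂ E] [NormedAddCommGroup F] [InnerProductSpace ℂ F] (K : Submodule ℂ E)
    [K.HasOrthogonalProjection] (W : K →ₗᵢ[ℂ] F) :
    IsPartialIsometry (W.toContinuousLinearMap ∘L K.orthogonalProjectionOnto) := by
  intro g hg
  have hgK : g ∈ K := by
    rw [← K.orthogonal_orthogonal]
    refine Submodule.orthogonal_le (fun x hx => ?_) hg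
    simp [Submodule.orthogonalProjectionOnto_eq_zero_iff.2 hx]
  have h := K.orthogonalProjectionOnto_mem_subspace_eq_self ⟨g, hgK⟩
  simp only at h
  simp [h]

end

end ClarkSeveral

/-! ### Assembly of `U` and `V`. -/

theorem mainTheorem3 (D : ClarkSeveral.Dom) (n : ℕ) (hn : 2 ≤ n)
    (b : ClarkSeveral.Cn n → ℂ) (hb : DifferentiableOn ℂ b (D.region n))
    (hb_lt : ∀ z ∈ D.region n, ‖b z‖ < 1)
    (hb_nc : ∃ z ∈ D.region n, ∃ w ∈ D.region n, b z ≠ b w)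
    (α : ℂ) (hα : ‖α‖ = 1)
    (σ : Measure (D.bdry n)) [IsFiniteMeasure σ] (hσ : ClarkSeveral.IsClarkMeasure D b α σ) :
    -- the kernel is positive semidefinite, so that the Hilbert space `ℋ(b)` is defined
    ∃ _ : Fact (ClarkSeveral.kbMatrix D b).PosSemidef,
    ∃ V : Lp ℂ 2 σ →L[ℂ] ClarkSeveral.DBR D b,
      (∀ (g : Lp ℂ 2 σ) (z : D.region n),
        V g z = (1 - conj α * b z) * ClarkSeveral.cauchyTransform D σ g z) ∧
      ClarkSeveral.IsPartialIsometry V ∧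
      -- `U` is the unitary operator `U_{b,α}` from `ℋ(b)` onto `H²(σ)`
      (∃ U : ClarkSeveral.DBR D b ≃ₗᵢ[ℂ] ClarkSeveral.H2 D σ,
        (∀ w : D.region n, U (ClarkSeveral.kbElem D b w) =
          (1 - α * conj (b w)) • ClarkSeveral.cauchyH2 D σ w) ∧
        (∀ T : ClarkSeveral.DBR D b →L[ℂ] ClarkSeveral.H2 D σ,
          (∀ w : D.region n, T (ClarkSeveral.kbElem D b w) =
            (1 - α * conj (b w)) • ClarkSeveral.cauchyH2 D σ w) → ∀ f, T f = U f) ∧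
        ∀ g : ClarkSeveral.H2 D σ, V (g : Lp ℂ 2 σ) =
          ContinuousLinearMap.adjoint
            (U : ClarkSeveral.DBR D b →L[ℂ] ClarkSeveral.H2 D σ) g) ∧
      ∀ z w : D.region n, V (ClarkSeveral.cauchyLp D σ w) z =
        (1 - α * conj (b w))⁻¹ * ClarkSeveral.kb D b z w := by
  have hne : ∀ w : D.region n, 1 - α * conj (b w) ≠ 0 := fun w =>
    ClarkSeveral.one_sub_ne_zero_of_norm_lt (by
      rw [norm_mul, hα, one_mul, RCLike.norm_conj]
      exact hb_lt w w.2)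
  have hgram : ∀ z w : D.region n, ⟪(1 - α * conj (b z)) • ClarkSeveral.cauchyH2 D σ z,
      (1 - α * conj (b w)) • ClarkSeveral.cauchyH2 D σ w⟫_ℂ = ClarkSeveral.kb D b z w := by
    intro z w
    rw [inner_smul_left, inner_smul_right, Submodule.coe_inner,
      ClarkSeveral.kb_eq_mul_integral hb hb_lt hα hσ z.2 w.2,
      ← ClarkSeveral.inner_cauchyLp_cauchyLp]
    simp [ClarkSeveral.cauchyH2, mul_assoc]
  have hF : Fact (ClarkSeveral.kbMatrix D b).PosSemidef :=
    ⟨ClarkSeveral.posSemidef_kbMatrix_of_inner_eq hgram⟩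
  obtain ⟨U, hU⟩ := ClarkSeveral.exists_linearIsometryEquiv_of_inner_eq
    (u := ClarkSeveral.kbElem D b)
    (v := fun w : D.region n => (1 - α * conj (b w)) • ClarkSeveral.cauchyH2 D σ w)
    (fun z w => by rw [hgram, ClarkSeveral.inner_kbElem, ClarkSeveral.kbElem_apply])
    ClarkSeveral.eq_zero_of_inner_kbElem
    (fun x hx => ClarkSeveral.eq_zero_of_inner_cauchyH2 σ x fun z => by
      have h := hx z
      rw [inner_smul_left, mul_eq_zero] at h
      exact h.resolve_left ((map_ne_zero _).2 (hne z)))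
  have hV : ∀ (g : Lp ℂ 2 σ) (z : D.region n),
      U.symm ((ClarkSeveral.H2 D σ).orthogonalProjectionOnto g) z =
        (1 - conj α * b z) * ⟪ClarkSeveral.cauchyLp D σ z, g⟫_ℂ := by
    intro g z
    -- Evaluation at `z` is pairing with `k_z`; applying `U` to both sides pairs a multiple of `C(·,
    -- z)` with the projection of `g`, which may be replaced by `g` because `C(·, z)` lies in
    -- `H²(σ)`.
    rw [← ClarkSeveral.inner_kbElem, ← U.inner_map_map, hU, U.apply_symm_apply, inner_smul_left,
      Submodule.inner_orthogonalProjectionOnto_eq_of_mem_left]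
    simp [ClarkSeveral.cauchyH2]
  refine ⟨hF, U.symm.toLinearIsometry.toContinuousLinearMap ∘L
    (ClarkSeveral.H2 D σ).orthogonalProjectionOnto, fun g z => ?_,
    ClarkSeveral.isPartialIsometry_comp_orthogonalProjectionOnto _ _,
    ⟨U, hU, fun T hT f => ?_, fun g => ?_⟩, fun z w => ?_⟩
  · rw [← ClarkSeveral.inner_cauchyLp_left]
    exact hV g z
  · have h : Set.EqOn T (U : ClarkSeveral.DBR D b →L[ℂ] ClarkSeveral.H2 D σ)
        (Set.range (ClarkSeveral.kbElem D b)) := by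
      rintro _ ⟨w, rfl⟩
      exact (hT w).trans (hU w).symm
    have hd : Dense (Submodule.span ℂ (Set.range (ClarkSeveral.kbElem D b)) :
        Set (ClarkSeveral.DBR D b)) := by
      have := ClarkSeveral.denseRange_linearCombination_of_inner_eq_zero
        (ClarkSeveral.eq_zero_of_inner_kbElem (D := D) (b := b))
      rwa [DenseRange, ← LinearMap.coe_range, Finsupp.range_linearCombination] at this
    exact DFunLike.congr_fun (ContinuousLinearMap.ext_on hd h) f
  · rw [LinearIsometryEquiv.adjoint_eq_symm]
    simp
  · refine (hV _ z).trans ?_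
    rw [ClarkSeveral.inner_cauchyLp_cauchyLp,
      ClarkSeveral.kb_eq_mul_integral hb hb_lt hα hσ z.2 w.2, mul_right_comm, mul_assoc,
      mul_comm (∫ _, _ ∂_)]
    field_simp [hne w]
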